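/- Let $R$ be a left and right Noetherian ring (associative with identity) and let $A$ be a finitely generated left $R$-module. Write $(-)^*=\operatorname{Hom}(-,R)$. A left module $G$ over a ring $S$ is Gorenstein projective if there is an exact sequence of projective $S$-modules $\cdots\to P_1\to P_0\to P^0\to P^1\to\cdots$ that remains exact under $\operatorname{Hom}_S(-,P)$ for every projective $S$-module $P$, and $G\cong\operatorname{Im}(P_0\to P^0)$. The Gorenstein projective dimension $\operatorname{Gpd}_S(M)\in\mathbb N\cup\{\infty\}$ is the infimum of all $n\ge 0$ for which there exists an exact sequence $0\to G_n\to\cdots\to G_0\to M\to 0$ with all $G_i$ Gorenstein projective. A Gorenstein transpose of a finitely generated (left or right) $R$-module $B$ is a module isomorphic to $\operatorname{Coker}(g^*: X_0^*\to X_1^*)$ for some exact sequence $X_1\xrightarrow{g}X_0\to B\to 0$ with $X_0,X_1$ finitely generated Gorenstein projective; it is a module on the opposite side. If $X_0,X_1$ are projective, it is called a transpose of $B$, denoted $\operatorname{Tr}B$ (unique up to projective equivalence). For $n\ge1$, a finitely generated left $R$-module $B$ is $n$-torsionfree if $\operatorname{Ext}^i_{R^{op}}(\operatorname{Tr}B,R)=0$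 for all $1\le i\le n$. Let the right $R$-module $M$ be any Gorenstein transpose of $A$, and let the left $R$-module $N$ be any Gorenstein transpose of $M$. Then: 1. $\operatorname{Ext}^i_R(N,R)\cong\operatorname{Ext}^i_R(A,R)$ as right $R$-modules for every $i\ge 1$. 2. For every $n\ge 1$, $N$ is $n$-torsionfree if and only if $A$ is $n$-torsionfree. 3. $\operatorname{Gpd}_R(N)=\operatorname{Gpd}_R(A)$. -/

import Mathlib

open CategoryTheory

universe u

namespace GorensteinTranspose

/-! ## Gorenstein projective modules and Gorenstein projective dimension -/

section Gorenstein

variable (S : Type u) [Ring S]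

/-- A module `G` is Gorenstein projective if there is an exact sequence
`⋯ → P 2 → P 1 → P 0 → P (-1) → ⋯` of projective modules (indexed by all integers) which
stays exact after applying `Hom(-, Q)` for every projective module `Q`, and such that `G` is
isomorphic to the image of `P 1 → P 0`. No finiteness is imposed on the `P i` and `Q`. -/
def IsGorensteinProjective (G : Type u) [AddCommGroup G] [Module S G] : Prop :=
  ∃ (P : ℤ → ModuleCat.{u} S) (d : ∀ i : ℤ, P (i + 1) →ₗ[S] P i),
    (∀ i, Module.Projective S (P i)) ∧
    (∀ i, Function.Exact (d (i + 1)) (d i)) ∧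
    (∀ Q : ModuleCat.{u} S, Module.Projective S Q → ∀ i : ℤ,
      Function.Exact (fun h : P i →ₗ[S] Q => h ∘ₗ d i)
        (fun h : P (i + 1) →ₗ[S] Q => h ∘ₗ d (i + 1))) ∧
    Nonempty (G ≃ₗ[S] LinearMap.range (d 0))

/-- There is an exact sequence `0 → G n → ⋯ → G 1 → G 0 → M → 0` with all `G i` Gorenstein
projective. The sequence is indexed by all natural numbers, with `G i = 0` for `i > n`. -/
def HasGorensteinResolution (n : ℕ) (M : Type u) [AddCommGroup M] [Module S M] : Prop :=
  ∃ (G : ℕ → ModuleCat.{u} S) (d : ∀ i : ℕ, G (i + 1) →ₗ[S] G i) (ε : G 0 →ₗ[S] M),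
    (∀ i ≤ n, IsGorensteinProjective S (G i)) ∧
    (∀ i > n, Subsingleton (G i)) ∧
    (∀ i, Function.Exact (d (i + 1)) (d i)) ∧
    Function.Exact (d 0) ε ∧
    Function.Surjective ε

/-- The Gorenstein projective dimension: the infimum of the lengths `n` of the resolutions of
`M` by Gorenstein projective modules, and `⊤` if there is no finite one. -/
noncomputable def Gpd (M : Type u) [AddCommGroup M] [Module S M] : ℕ∞ :=
  ⨅ (n : ℕ) (_ : HasGorensteinResolution S n M), (n : ℕ∞)

end Gorenstein

/-! ## Duals, Ext and transposes

Everything is written for two rings `S`, `T` and an abelian group `D` with commuting actions of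
`S` and `T`, so that left and right modules over a ring `R` are treated at once: left modules are
the case `S = R`, `T = Rᵐᵒᵖ`, `D = R`, and right modules are the case `S = Rᵐᵒᵖ`, `T = R`, `D = R`. -/

section Bimodule

variable (S T D : Type u) [Ring S] [Ring T] [AddCommGroup D] [Module S D] [Module T D]
  [SMulCommClass S T D]

/-- The `T`-linear map `g^* : Hom_S(Y, D) → Hom_S(X, D)`, `h ↦ h ∘ g`. -/
def dualMap {X Y : Type u} [AddCommGroup X] [Module S X] [AddCommGroup Y] [Module S Y]
    (g : X →ₗ[S] Y) : (Y →ₗ[S] D) →ₗ[T] (X →ₗ[S] D) where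
  toFun h := h ∘ₗ g
  map_add' _ _ := rfl
  map_smul' _ _ := rfl

/-- `Ext_S^i(X, D)`. -/
def ExtD (X : Type u) [AddCommGroup X] [Module S X] (i : ℕ) : Type u :=
  Abelian.Ext.{u} (ModuleCat.of S X) (ModuleCat.of S D) i

noncomputable instance (X : Type u) [AddCommGroup X] [Module S X] (i : ℕ) :
    AddCommGroup (ExtD S D X i) :=
  inferInstanceAs (AddCommGroup (Abelian.Ext.{u} (ModuleCat.of S X) (ModuleCat.of S D) i))

/-- Multiplication by `t : T` on `D`, as a morphism of `S`-modules. -/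
def mulHom (t : T) : ModuleCat.of S D ⟶ ModuleCat.of S D :=
  ModuleCat.ofHom
    { toFun := fun x => t • x
      map_add' := fun x y => smul_add t x y
      map_smul' := fun s x => (smul_comm s t x).symm }

/-- The `T`-module structure of `Ext_S^i(X, D)`, induced by functoriality in `D`: the element `t`
acts by composition with multiplication by `t` on `D`. -/
@[reducible]
noncomputable def extModule (X : ModuleCat.{u} S) (i : ℕ) :
    Module T (Abelian.Ext.{u} X (ModuleCat.of S D) i) where
  smul t x := x.comp (Abelian.Ext.mk₀ (mulHom S T D t)) (add_zero i)
  one_smul x := by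
    have h : mulHom S T D 1 = 𝟙 _ := by ext x; exact one_smul T (x : D)
    change x.comp (Abelian.Ext.mk₀ (mulHom S T D 1)) (add_zero i) = x
    rw [h, Abelian.Ext.comp_mk₀_id]
  mul_smul s t x := by
    have h : mulHom S T D (s * t) = mulHom S T D t ≫ mulHom S T D s := by
      ext x; exact mul_smul s t (x : D)
    change x.comp (Abelian.Ext.mk₀ (mulHom S T D (s * t))) (add_zero i) =
      (x.comp (Abelian.Ext.mk₀ (mulHom S T D t)) (add_zero i)).comp
        (Abelian.Ext.mk₀ (mulHom S T D s)) (add_zero i)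
    rw [h, ← Abelian.Ext.mk₀_comp_mk₀, Abelian.Ext.comp_assoc_of_third_deg_zero]
  smul_zero t := by
    change (0 : Abelian.Ext.{u} X (ModuleCat.of S D) i).comp
      (Abelian.Ext.mk₀ (mulHom S T D t)) (add_zero i) = 0
    rw [Abelian.Ext.zero_comp]
  smul_add t x y := Abelian.Ext.add_comp _ _ _ _
  add_smul s t x := by
    have h : mulHom S T D (s + t) = mulHom S T D s + mulHom S T D t := by
      ext x; exact add_smul s t (x : D)
    change x.comp (Abelian.Ext.mk₀ (mulHom S T D (s + t))) (add_zero i) =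
      x.comp (Abelian.Ext.mk₀ (mulHom S T D s)) (add_zero i) +
      x.comp (Abelian.Ext.mk₀ (mulHom S T D t)) (add_zero i)
    rw [h, Abelian.Ext.mk₀_add, Abelian.Ext.comp_add]
  zero_smul x := by
    have h : mulHom S T D 0 = 0 := by ext x; exact zero_smul T (x : D)
    change x.comp (Abelian.Ext.mk₀ (mulHom S T D 0)) (add_zero i) = 0
    rw [h, Abelian.Ext.mk₀_zero, Abelian.Ext.comp_zero]

noncomputable instance (X : Type u) [AddCommGroup X] [Module S X] (i : ℕ) :
    Module T (ExtD S D X i) :=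
  extModule S T D (ModuleCat.of S X) i

/-- The `T`-module `M` is (isomorphic to) a transpose of the `S`-module `A`, that is, the cokernel
of `f^*` for a presentation `P₁ --f--> P₀ → A → 0` by finitely generated projective modules. -/
def IsTranspose (A : Type u) [AddCommGroup A] [Module S A]
    (M : Type u) [AddCommGroup M] [Module T M] : Prop :=
  ∃ (P₁ P₀ : ModuleCat.{u} S) (f : P₁ →ₗ[S] P₀) (p : P₀ →ₗ[S] A),
    Module.Finite S P₁ ∧ Module.Finite S P₀ ∧
    Module.Projective S P₁ ∧ Module.Projective S P₀ ∧
    Function.Exact f p ∧ Function.Surjective p ∧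
    Nonempty (M ≃ₗ[T] ((P₁ →ₗ[S] D) ⧸ LinearMap.range (dualMap S T D f)))

/-- The `T`-module `M` is (isomorphic to) a Gorenstein transpose of the `S`-module `A`, that is,
the cokernel of `g^*` for a presentation `X₁ --g--> X₀ → A → 0` by finitely generated Gorenstein
projective modules. -/
def IsGorensteinTranspose (A : Type u) [AddCommGroup A] [Module S A]
    (M : Type u) [AddCommGroup M] [Module T M] : Prop :=
  ∃ (X₁ X₀ : ModuleCat.{u} S) (g : X₁ →ₗ[S] X₀) (p : X₀ →ₗ[S] A),
    Module.Finite S X₁ ∧ Module.Finite S X₀ ∧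
    IsGorensteinProjective S X₁ ∧ IsGorensteinProjective S X₀ ∧
    Function.Exact g p ∧ Function.Surjective p ∧
    Nonempty (M ≃ₗ[T] ((X₁ →ₗ[S] D) ⧸ LinearMap.range (dualMap S T D g)))

/-- `A` is `n`-torsionfree if `Ext_T^i(Tr A, D) = 0` for `1 ≤ i ≤ n`. Since `Tr A` is unique up
to projective summands, it does not matter which transpose of `A` is taken. -/
def IsTorsionfree (n : ℕ) (A : Type u) [AddCommGroup A] [Module S A] : Prop :=
  ∃ M : ModuleCat.{u} T, IsTranspose S T D A M ∧
    ∀ i : ℕ, 1 ≤ i → i ≤ n → Subsingleton (ExtD T D M i)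

end Bimodule

end GorensteinTranspose

/-! Two facts carry the proof. The first is symmetry. A finitely generated Gorenstein projective
module is reflexive and its dual is again finitely generated Gorenstein projective, so dualizing a
presentation `X₁ → X₀ → A → 0` gives a presentation `X₀^* → X₁^* → M → 0` of the same kind, whose
Gorenstein transpose is `A` again (`IsGorensteinTranspose.symm`). Hence `A` and `N` are both
Gorenstein transposes of `M`, and `M` is one of `N`.

The second is that any two Gorenstein transposes of a module `B` embed into a common module with
Gorenstein projective cokernels (`IsGorensteinTranspose.exists_common_extension`). That module is
the ordinary transpose of `B` for a finite free presentation dominating both Gorenstein projective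
ones. An embedding of this kind changes neither `Ext^i(-, R)` for `i ≥ 1`, by the long exact
sequence (`ExtVanish.nonempty_extEquiv`), nor the Gorenstein projective dimension
(`Gpd_eq_of_isSES`). This gives 1 and 3. For 2, the same comparison lets the vanishing that defines
torsionfreeness be tested on any Gorenstein transpose, and `M` serves for both `A` and `N`.

The closure properties used on the way are proved coinductively: to be Gorenstein projective is to
lie in some class of modules with vanishing Ext into projectives that is closed under suitable
projective cosyzygies. -/

namespace GorensteinTranspose

/-! ## Short exact sequences and vanishing of Ext -/

section ExtVanishing

variable (S : Type u) [Ring S]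

/-- `0 → N → E → H → 0` is a short exact sequence of modules. -/
structure IsSES {S : Type u} [Ring S] {N E H : Type u} [AddCommGroup N] [Module S N]
    [AddCommGroup E] [Module S E] [AddCommGroup H] [Module S H]
    (f : N →ₗ[S] E) (g : E →ₗ[S] H) : Prop where
  inj : Function.Injective f
  exact : Function.Exact f g
  surj : Function.Surjective g

/-- All higher extension groups of `H` by projective modules vanish. -/
def ExtVanish (H : Type u) [AddCommGroup H] [Module S H] : Prop :=
  ∀ Q : ModuleCat.{u} S, Module.Projective S Q → ∀ i : ℕ,
    Subsingleton (Abelian.Ext.{u} (ModuleCat.of S H) Q (i + 1))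

variable {S}
variable {N E H : Type u} [AddCommGroup N] [Module S N]
    [AddCommGroup E] [Module S E] [AddCommGroup H] [Module S H]

/-- The short complex in `ModuleCat S` of a short exact sequence. -/
abbrev IsSES.complex {f : N →ₗ[S] E} {g : E →ₗ[S] H} (h : IsSES f g) :
    ShortComplex (ModuleCat.{u} S) :=
  ModuleCat.shortComplexOfCompEqZero f g h.exact.linearMap_comp_eq_zero

lemma IsSES.shortExact {f : N →ₗ[S] E} {g : E →ₗ[S] H} (h : IsSES f g) :
    h.complex.ShortExact :=
  ModuleCat.shortComplex_shortExact _ h.exact h.inj h.surj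

lemma isSES_ker {g : E →ₗ[S] H} (hg : Function.Surjective g) :
    IsSES (LinearMap.ker g).subtype g :=
  ⟨Subtype.val_injective, LinearMap.exact_subtype_ker_map g, hg⟩

lemma isSES_mkQ {f : N →ₗ[S] E} (hf : Function.Injective f) :
    IsSES f (LinearMap.range f).mkQ :=
  ⟨hf, LinearMap.exact_map_mkQ_range f, Submodule.mkQ_surjective _⟩

lemma IsSES.g_comp_f_apply {f : N →ₗ[S] E} {g : E →ₗ[S] H} (h : IsSES f g) (x : N) :
    g (f x) = 0 :=
  h.exact.apply_apply_eq_zero x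

/-- A map on the middle term vanishing on the left term factors through the right term. -/
lemma IsSES.exists_factor {f : N →ₗ[S] E} {g : E →ₗ[S] H} (h : IsSES f g)
    {Q : Type*} [AddCommGroup Q] [Module S Q] (k : E →ₗ[S] Q) (hk : ∀ x, k (f x) = 0) :
    ∃ l : H →ₗ[S] Q, ∀ x, l (g x) = k x := by
  have hle : LinearMap.ker g ≤ LinearMap.ker k := by
    intro x hx
    obtain ⟨y, rfl⟩ := (h.exact x).1 hx
    exact hk y
  refine ⟨((LinearMap.ker g).liftQ k hle) ∘ₗ
    (g.quotKerEquivOfSurjective h.surj).symm.toLinearMap, fun x => ?_⟩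
  have : (g.quotKerEquivOfSurjective h.surj).symm (g x) = (LinearMap.ker g).mkQ x := by
    rw [LinearEquiv.symm_apply_eq]
    rfl
  simp only [LinearMap.comp_apply, LinearEquiv.coe_coe, this]
  simp

lemma ExtVanish.of_projective [Module.Projective S H] : ExtVanish S H := by
  intro Q _ i
  have : Projective (ModuleCat.of S H) := (IsProjective.iff_projective H).1 inferInstance
  exact Abelian.Ext.subsingleton_of_projective _ _ _

lemma ExtVanish.of_extension {f : N →ₗ[S] E} {g : E →ₗ[S] H} (h : IsSES f g)
    (hN : ExtVanish S N) (hH : ExtVanish S H) : ExtVanish S E := by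
  intro Q hQ i
  refine subsingleton_of_forall_eq 0 fun x => ?_
  have := hN Q hQ i
  have := hH Q hQ i
  obtain ⟨y, hy⟩ := Abelian.Ext.contravariant_sequence_exact₂ h.shortExact Q x
    (Subsingleton.elim (α := Abelian.Ext.{u} (ModuleCat.of S N) Q (i + 1)) _ _)
  rw [← hy, Subsingleton.elim (α := Abelian.Ext.{u} (ModuleCat.of S H) Q (i + 1)) y 0,
    Abelian.Ext.comp_zero]

lemma ExtVanish.of_epi {f : N →ₗ[S] E} {g : E →ₗ[S] H} (h : IsSES f g)
    (hE : ExtVanish S E) (hH : ExtVanish S H) : ExtVanish S N := by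
  intro Q hQ i
  refine subsingleton_of_forall_eq 0 fun x => ?_
  have := hE Q hQ i
  have := hH Q hQ (i + 1)
  obtain ⟨y, hy⟩ := Abelian.Ext.contravariant_sequence_exact₁ h.shortExact Q x
    (add_comm 1 (i + 1))
    (Subsingleton.elim (α := Abelian.Ext.{u} (ModuleCat.of S H) Q (i + 1 + 1)) _ _)
  rw [← hy, Subsingleton.elim (α := Abelian.Ext.{u} (ModuleCat.of S E) Q (i + 1)) y 0,
    Abelian.Ext.comp_zero]

/-- The obstruction to extending `k` along `f` lies in `Ext^1(H, Q)`. -/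
lemma ExtVanish.extend {f : N →ₗ[S] E} {g : E →ₗ[S] H} (h : IsSES f g)
    (hH : ExtVanish S H) {Q : Type u} [AddCommGroup Q] [Module S Q] [hQ : Module.Projective S Q]
    (k : N →ₗ[S] Q) : ∃ l : E →ₗ[S] Q, ∀ x, l (f x) = k x := by
  have := hH (ModuleCat.of S Q) hQ 0
  obtain ⟨y, hy⟩ := Abelian.Ext.contravariant_sequence_exact₁ h.shortExact (ModuleCat.of S Q)
    (Abelian.Ext.mk₀ (ModuleCat.ofHom k)) (add_comm 1 0)
    (Subsingleton.elim (α := Abelian.Ext.{u} (ModuleCat.of S H) (ModuleCat.of S Q) (0 + 1)) _ _)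
  obtain ⟨l, rfl⟩ := (Abelian.Ext.mk₀_bijective _ _).2 y
  rw [Abelian.Ext.mk₀_comp_mk₀] at hy
  have hy := (Abelian.Ext.mk₀_bijective _ _).1 hy
  exact ⟨l.hom, fun x => LinearMap.congr_fun (congrArg ModuleCat.Hom.hom hy) x⟩

/-- A class of modules closed under syzygies along which maps to projective modules extend
consists of modules with vanishing extension groups. -/
lemma ExtVanish.of_class (W : ModuleCat.{u} S → Prop)
    (hW : ∀ X, W X → ∃ (K P : ModuleCat.{u} S) (f : K →ₗ[S] P) (g : P →ₗ[S] X),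
      Module.Projective S P ∧ IsSES f g ∧ W K ∧
      ∀ Q : ModuleCat.{u} S, Module.Projective S Q → ∀ k : K →ₗ[S] Q,
        ∃ l : P →ₗ[S] Q, ∀ x, l (f x) = k x)
    (X : ModuleCat.{u} S) (hX : W X) : ExtVanish S X := by
  intro Q hQ i
  induction i generalizing X with
  | zero =>
    obtain ⟨K, P, f, g, hP, h, -, hl⟩ := hW X hX
    have := ExtVanish.of_projective (S := S) (H := P) Q hQ 0
    refine subsingleton_of_forall_eq 0 fun x => ?_
    -- A class in `Ext^1(X, Q)` is the extension class followed by some `k : K → Q`. As `k` extends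
    -- to `P`, the composite passes through the extension class followed by `f`, which is zero.
    -- Higher degrees follow by dimension shifting.
    obtain ⟨y, rfl⟩ := Abelian.Ext.contravariant_sequence_exact₃ h.shortExact Q x
      (Subsingleton.elim (α := Abelian.Ext.{u} (ModuleCat.of S P) Q (0 + 1)) _ _) (add_comm 1 0)
    obtain ⟨k, rfl⟩ := (Abelian.Ext.mk₀_bijective _ _).2 y
    obtain ⟨l, hl⟩ := hl Q hQ k.hom
    have : k = h.complex.f ≫ ModuleCat.ofHom l := by
      ext x
      exact (hl x).symm
    rw [this, ← Abelian.Ext.mk₀_comp_mk₀, h.shortExact.extClass_comp_assoc]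
  | succ i ih =>
    obtain ⟨K, P, f, g, hP, h, hK, -⟩ := hW X hX
    have := ExtVanish.of_projective (S := S) (H := P) Q hQ (i + 1)
    have := ih K hK
    refine subsingleton_of_forall_eq 0 fun x => ?_
    obtain ⟨y, rfl⟩ := Abelian.Ext.contravariant_sequence_exact₃ h.shortExact Q x
      (Subsingleton.elim (α := Abelian.Ext.{u} (ModuleCat.of S P) Q (i + 1 + 1)) _ _)
      (add_comm 1 (i + 1))
    rw [Subsingleton.elim (α := Abelian.Ext.{u} (ModuleCat.of S K) Q (i + 1)) y 0,
      Abelian.Ext.comp_zero]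

end ExtVanishing

/-! ## Gorenstein projective modules as the largest class with projective cosyzygies -/

section GorensteinClass

variable (S : Type u) [Ring S]

/-- The modules in the class have vanishing Ext into projective modules and embed into projective
modules with cokernel in the class. -/
def IsGorensteinClass (W : ModuleCat.{u} S → Prop) : Prop :=
  ∀ X, W X → ExtVanish S X ∧
    ∃ (P Y : ModuleCat.{u} S) (f : X →ₗ[S] P) (g : P →ₗ[S] Y),
      Module.Projective S P ∧ IsSES f g ∧ W Y

variable {S}

/-- The class is that of all images of differentials in one complete resolution. -/
lemma IsGorensteinProjective.exists_class {G : Type u} [AddCommGroup G] [Module S G]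
    (hG : IsGorensteinProjective S G) :
    ∃ W : ModuleCat.{u} S → Prop, IsGorensteinClass S W ∧ W (ModuleCat.of S G) := by
  obtain ⟨P, d, hP, hd, hQ, he⟩ := hG
  have hses : ∀ i, IsSES (LinearMap.range (d (i + 1))).subtype (d i).rangeRestrict := by
    refine fun i => ⟨Subtype.val_injective, fun y => ?_, LinearMap.surjective_rangeRestrict _⟩
    rw [Subtype.ext_iff]
    simpa using hd i y
  -- Exactness under `Hom(-, Q)` says precisely that maps from the images to projectives extend to
  -- the terms.
  have hlift : ∀ (i : ℤ) (Q : ModuleCat.{u} S), Module.Projective S Q →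
      ∀ k : LinearMap.range (d i) →ₗ[S] Q, ∃ l : P i →ₗ[S] Q,
        ∀ x, l ((LinearMap.range (d i)).subtype x) = k x := by
    intro i Q hQ' k
    obtain ⟨l, hl⟩ := (hQ Q hQ' i (k ∘ₗ (d i).rangeRestrict)).1 (by
      ext x
      have : (d i).rangeRestrict (d (i + 1) x) = 0 :=
        Subtype.ext ((hd i).apply_apply_eq_zero x)
      simp only [LinearMap.comp_apply, this, map_zero, LinearMap.zero_apply])
    refine ⟨l, ?_⟩
    rintro ⟨_, x, rfl⟩
    exact LinearMap.congr_fun hl x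
  refine ⟨fun X => ∃ i, Nonempty (X ≃ₗ[S] LinearMap.range (d i)), fun X hX => ⟨?_, ?_⟩, 0, he⟩
  · refine ExtVanish.of_class (fun X => ∃ i, Nonempty (X ≃ₗ[S] LinearMap.range (d i))) ?_ X hX
    rintro X ⟨i, ⟨e⟩⟩
    refine ⟨ModuleCat.of S (LinearMap.range (d (i + 1))), P (i + 1), _,
      e.symm.toLinearMap ∘ₗ (d i).rangeRestrict, hP _,
      ⟨(hses i).inj, ?_, e.symm.surjective.comp (hses i).surj⟩, ⟨_, ⟨LinearEquiv.refl _ _⟩⟩,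
      hlift (i + 1)⟩
    intro y
    simpa using (hses i).exact y
  · obtain ⟨i, ⟨e⟩⟩ := hX
    obtain ⟨j, rfl⟩ : ∃ j, i = j + 1 := ⟨i - 1, by simp⟩
    refine ⟨P (j + 1), ModuleCat.of S (LinearMap.range (d j)),
      (LinearMap.range (d (j + 1))).subtype ∘ₗ e.toLinearMap, (d j).rangeRestrict, hP _,
      ⟨(hses j).inj.comp e.injective, fun y => ?_, (hses j).surj⟩, j, ⟨LinearEquiv.refl _ _⟩⟩
    refine ((hses j).exact y).trans ⟨?_, ?_⟩
    · rintro ⟨x, rfl⟩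
      exact ⟨e.symm x, by simp⟩
    · rintro ⟨x, rfl⟩
      exact ⟨e x, rfl⟩

/-- Membership in some Gorenstein class. -/
def InGorensteinClass (X : ModuleCat.{u} S) : Prop :=
  ∃ W : ModuleCat.{u} S → Prop, IsGorensteinClass S W ∧ W X

/-- The condition only asserts existence inside the class, so it passes to unions and there is a
largest class. Membership can then be proved by exhibiting any class containing the module. -/
lemma isGorensteinClass_inGorensteinClass :
    IsGorensteinClass S (InGorensteinClass (S := S)) := by
  rintro X ⟨W, hW, hX⟩
  obtain ⟨h, P, Y, f, g, hP, hfg, hY⟩ := hW X hX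
  exact ⟨h, P, Y, f, g, hP, hfg, W, hW, hY⟩

/-- Adjoining `K` to the largest class preserves the defining condition, since its cosyzygy `X` is
already there. -/
lemma InGorensteinClass.of_ses {K P X : ModuleCat.{u} S} {f : K →ₗ[S] P} {g : P →ₗ[S] X}
    (hP : Module.Projective S P) (h : IsSES f g) (hX : InGorensteinClass X) :
    InGorensteinClass K := by
  refine ⟨fun Z => Z = K ∨ InGorensteinClass Z, ?_, Or.inl rfl⟩
  rintro Z (rfl | hZ)
  · exact ⟨ExtVanish.of_epi h ExtVanish.of_projective
      (isGorensteinClass_inGorensteinClass X hX).1, P, X, f, g, hP, h, Or.inr hX⟩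
  · obtain ⟨h, P, Y, f, g, hP, hfg, hY⟩ := isGorensteinClass_inGorensteinClass Z hZ
    exact ⟨h, P, Y, f, g, hP, hfg, Or.inr hY⟩

lemma InGorensteinClass.exists_cover {X : ModuleCat.{u} S} (hX : InGorensteinClass X) :
    ∃ (K P : ModuleCat.{u} S) (f : K →ₗ[S] P) (g : P →ₗ[S] X),
      Module.Projective S P ∧ IsSES f g ∧ InGorensteinClass K := by
  have h := isSES_ker (Finsupp.linearCombination_id_surjective S X)
  have hP : Module.Projective S (ModuleCat.of S (X →₀ S)) :=
    inferInstanceAs (Module.Projective S (X →₀ S))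
  exact ⟨ModuleCat.of S (LinearMap.ker (Finsupp.linearCombination S (id : X → X))),
    ModuleCat.of S (X →₀ S), _, _, hP, h, InGorensteinClass.of_ses
      (K := ModuleCat.of S (LinearMap.ker (Finsupp.linearCombination S (id : X → X)))) hP h hX⟩

/-- A relation that is total on both sides admits bi-infinite chains through any point. -/
lemma exists_int_chain {W : Type*} (r : W → W → Prop) (hl : ∀ w, ∃ w', r w' w)
    (hr : ∀ w, ∃ w', r w w') (w : W) : ∃ z : ℤ → W, z 1 = w ∧ ∀ i, r (z (i + 1)) (z i) := by
  choose f hf using hl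
  choose g hg using hr
  let z : ℤ → W := Int.rec (fun n => f^[n] w) (fun n => g^[n + 1] w)
  have hz : ∀ i, r (z (i + 1)) (z i) := by
    rintro (n | n)
    · change r (f^[n + 1] w) (f^[n] w)
      rw [Function.iterate_succ_apply']
      exact hf _
    · rcases n with _ | n
      · exact hg w
      · change r (g^[n + 1] w) (g^[n + 1 + 1] w)
        rw [Function.iterate_succ_apply' g (n + 1)]
        exact hg _
  -- The shift by one puts the base point at index 1: in the complex built from the chain, the image
  -- of `P 1 → P 0` is the module `z 1`.
  refine ⟨fun i => z (i - 1), rfl, fun i => ?_⟩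
  have := hz (i - 1)
  rw [sub_add_cancel] at this
  simpa only [add_sub_cancel_right] using this

/-- Free covers to the left and projective embeddings to the right, all with third term in the
class, are spliced into a complete resolution. -/
lemma InGorensteinClass.isGorensteinProjective {X : ModuleCat.{u} S}
    (hX : InGorensteinClass X) : IsGorensteinProjective S X := by
  obtain ⟨z, hz, hr⟩ := exists_int_chain
    (W := {Y : ModuleCat.{u} S // InGorensteinClass Y})
    (fun K Y => ∃ (P : ModuleCat.{u} S) (f : K.1 →ₗ[S] P) (g : P →ₗ[S] Y.1),
      Module.Projective S P ∧ IsSES f g)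
    (fun Y => by
      obtain ⟨K, P, f, g, hP, h, hK⟩ := Y.2.exists_cover
      exact ⟨⟨K, hK⟩, P, f, g, hP, h⟩)
    (fun K => by
      obtain ⟨-, P, Y, f, g, hP, h, hY⟩ := isGorensteinClass_inGorensteinClass K.1 K.2
      exact ⟨⟨Y, hY⟩, P, f, g, hP, h⟩) ⟨X, hX⟩
  choose Q a b hQ h using hr
  refine ⟨Q, fun i => a i ∘ₗ b (i + 1), hQ, fun i y => ?_, fun P hP i k => ?_, ?_⟩
  · refine Iff.trans ⟨fun hy => ?_, fun hy => ?_⟩ (((h (i + 1)).exact y).trans ⟨?_, ?_⟩)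
    · exact (h i).inj (by simpa using hy)
    · simp [hy]
    · rintro ⟨x, rfl⟩
      obtain ⟨x, rfl⟩ := (h (i + 1 + 1)).surj x
      exact ⟨x, rfl⟩
    · rintro ⟨x, rfl⟩
      exact ⟨_, rfl⟩
  · constructor
    · intro hk
      -- A cocycle factors through the syzygy `z (i + 1)` and extends to `Q i`, because the cokernel
      -- `z i` has vanishing `Ext^1`.
      obtain ⟨l, hl⟩ := (h (i + 1)).exists_factor k (fun x => by
        obtain ⟨x, rfl⟩ := (h (i + 1 + 1)).surj x
        exact LinearMap.congr_fun hk x)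
      obtain ⟨m, hm⟩ := ExtVanish.extend (h i)
        (isGorensteinClass_inGorensteinClass _ (z i).2).1 l
      refine ⟨m, ?_⟩
      ext x
      simp [hm, hl]
    · rintro ⟨l, rfl⟩
      ext x
      simp [(h (i + 1)).g_comp_f_apply]
  · have h0 : LinearMap.range (a 0 ∘ₗ b (0 + 1)) = LinearMap.range (a 0) :=
      LinearMap.range_comp_of_range_eq_top _ (LinearMap.range_eq_top.2 (h (0 + 1)).surj)
    have hz' : (z (0 + 1)).1 = X := by
      rw [zero_add, hz]
    have e : Nonempty (X ≃ₗ[S] (z (0 + 1)).1) := by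
      rw [hz']
      exact ⟨LinearEquiv.refl _ _⟩
    obtain ⟨e⟩ := e
    exact ⟨e.trans ((LinearEquiv.ofInjective (a 0) (h 0).inj).trans (LinearEquiv.ofEq _ _ h0.symm))⟩

lemma IsGorensteinProjective.inGorensteinClass {G : Type u} [AddCommGroup G] [Module S G]
    (hG : IsGorensteinProjective S G) : InGorensteinClass (ModuleCat.of S G) :=
  hG.exists_class

lemma isGorensteinProjective_of_class (W : ModuleCat.{u} S → Prop) (hW : IsGorensteinClass S W)
    (X : ModuleCat.{u} S) (hX : W X) : IsGorensteinProjective S X :=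
  InGorensteinClass.isGorensteinProjective ⟨W, hW, hX⟩

end GorensteinClass

/-! ## Closure properties of Gorenstein projective modules -/

section Closure

variable {S : Type u} [Ring S]
variable {N E H : Type u} [AddCommGroup N] [Module S N]
    [AddCommGroup E] [Module S E] [AddCommGroup H] [Module S H]

lemma IsGorensteinProjective.extVanish (hE : IsGorensteinProjective S E) : ExtVanish S E :=
  (isGorensteinClass_inGorensteinClass _ hE.inGorensteinClass).1

lemma IsGorensteinProjective.exists_embedding (hE : IsGorensteinProjective S E) :
    ∃ (P Y : ModuleCat.{u} S) (f : E →ₗ[S] P) (g : P →ₗ[S] Y),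
      Module.Projective S P ∧ IsSES f g ∧ IsGorensteinProjective S Y := by
  obtain ⟨-, P, Y, f, g, hP, h, hY⟩ :=
    isGorensteinClass_inGorensteinClass _ hE.inGorensteinClass
  exact ⟨P, Y, f, g, hP, h, hY.isGorensteinProjective⟩

lemma IsGorensteinProjective.exists_cover (hE : IsGorensteinProjective S E) :
    ∃ (K P : ModuleCat.{u} S) (f : K →ₗ[S] P) (g : P →ₗ[S] E),
      Module.Projective S P ∧ IsSES f g ∧ IsGorensteinProjective S K := by
  obtain ⟨K, P, f, g, hP, h, hK⟩ := hE.inGorensteinClass.exists_cover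
  exact ⟨K, P, f, g, hP, h, hK.isGorensteinProjective⟩

lemma IsGorensteinProjective.congr (e : N ≃ₗ[S] E) (hE : IsGorensteinProjective S E) :
    IsGorensteinProjective S N := by
  obtain ⟨P, d, h₁, h₂, h₃, ⟨e'⟩⟩ := hE
  exact ⟨P, d, h₁, h₂, h₃, ⟨e.trans e'⟩⟩

lemma IsGorensteinProjective.of_projective [hE : Module.Projective S E] :
    IsGorensteinProjective S E := by
  refine isGorensteinProjective_of_class (fun X => Module.Projective S X) ?_ (ModuleCat.of S E) hE
  intro X hX
  refine ⟨ExtVanish.of_projective, X, ModuleCat.of S PUnit.{u + 1}, LinearMap.id, 0, hX, ⟨?_, ?_, ?_⟩,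
    inferInstanceAs (Module.Projective S PUnit.{u + 1})⟩
  · exact Function.injective_id
  · exact fun y => ⟨fun _ => ⟨y, rfl⟩, fun _ => rfl⟩
  · exact fun y => ⟨0, rfl⟩

/-- A horseshoe argument, run on the class of all such extensions. The embedding `N → P` extends to
`E` since `Ext^1(H, P) = 0`, so `E` embeds into `P × Q`, and the cokernel is an extension of `H'` by
`N'`. -/
lemma IsGorensteinProjective.of_extension {f : N →ₗ[S] E} {g : E →ₗ[S] H} (h : IsSES f g)
    (hN : IsGorensteinProjective S N) (hH : IsGorensteinProjective S H) :
    IsGorensteinProjective S E := by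
  refine isGorensteinProjective_of_class (fun E => ∃ (N H : ModuleCat.{u} S) (f : N →ₗ[S] E)
    (g : E →ₗ[S] H), IsSES f g ∧ IsGorensteinProjective S N ∧ IsGorensteinProjective S H) ?_
    (ModuleCat.of S E) ⟨ModuleCat.of S N, ModuleCat.of S H, f, g, h, hN, hH⟩
  clear! N E H
  rintro E ⟨N, H, f, g, h, hN, hH⟩
  refine ⟨ExtVanish.of_extension h hN.extVanish hH.extVanish, ?_⟩
  obtain ⟨P, N', i, p, hP, hip, hN'⟩ := hN.exists_embedding
  obtain ⟨Q, H', j, q, hQ, hjq, hH'⟩ := hH.exists_embedding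
  obtain ⟨l, hl⟩ := ExtVanish.extend h hH.extVanish i
  let k : E →ₗ[S] P × Q := l.prod (j ∘ₗ g)
  have hk : Function.Injective k := by
    rw [injective_iff_map_eq_zero]
    intro x hx
    have h1 : l x = 0 := congrArg Prod.fst hx
    have h2 : j (g x) = 0 := congrArg Prod.snd hx
    obtain ⟨y, rfl⟩ := (h.exact x).1 (hjq.inj (h2.trans (map_zero j).symm))
    rw [hl] at h1
    rw [hip.inj (h1.trans (map_zero i).symm), map_zero]
  have hc := isSES_mkQ hk
  obtain ⟨a, ha⟩ := hip.exists_factor ((LinearMap.range k).mkQ ∘ₗ LinearMap.inl S P Q) (fun x => by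
    simp only [LinearMap.comp_apply, LinearMap.inl_apply, Submodule.mkQ_apply,
      Submodule.Quotient.mk_eq_zero]
    exact ⟨f x, by simp [k, hl, h.g_comp_f_apply]⟩)
  obtain ⟨b, hb⟩ := hc.exists_factor (q ∘ₗ LinearMap.snd S P Q) (fun x => by
    simp [k, hjq.g_comp_f_apply])
  refine ⟨ModuleCat.of S (P × Q), ModuleCat.of S ((P × Q) ⧸ LinearMap.range k), k, _,
    inferInstanceAs (Module.Projective S (P × Q)), hc, N', H', a, b, ⟨?_, ?_, ?_⟩, hN', hH'⟩
  · rw [injective_iff_map_eq_zero]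
    intro x hx
    obtain ⟨x, rfl⟩ := hip.surj x
    rw [ha] at hx
    simp only [LinearMap.comp_apply, LinearMap.inl_apply, Submodule.mkQ_apply,
      Submodule.Quotient.mk_eq_zero] at hx
    obtain ⟨y, hy⟩ := hx
    have h1 : l y = x := congrArg Prod.fst hy
    have h2 : j (g y) = 0 := congrArg Prod.snd hy
    obtain ⟨y, rfl⟩ := (h.exact y).1 (hjq.inj (h2.trans (map_zero j).symm))
    rw [← h1, hl, hip.g_comp_f_apply]
  · intro y
    constructor
    · intro hy
      obtain ⟨⟨y, z⟩, rfl⟩ := hc.surj y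
      rw [hb] at hy
      obtain ⟨w, hw⟩ := (hjq.exact z).1 hy
      obtain ⟨w, rfl⟩ := h.surj w
      refine ⟨p (y - l w), ?_⟩
      rw [ha]
      simp only [LinearMap.comp_apply, LinearMap.inl_apply, Submodule.mkQ_apply]
      rw [eq_comm, Submodule.Quotient.eq]
      exact ⟨w, by simp [k, hw]⟩
    · rintro ⟨x, rfl⟩
      obtain ⟨x, rfl⟩ := hip.surj x
      rw [ha, LinearMap.comp_apply, hb]
      simp
  · intro y
    obtain ⟨y, rfl⟩ := hjq.surj y
    exact ⟨(LinearMap.range k).mkQ (0, y), by rw [hb]; rfl⟩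

/-- Only one cosyzygy of `N` is needed: for an embedding `E → P` with cokernel `Y`, the cokernel of
`N → E → P` is an extension of `Y` by `H`. -/
lemma IsGorensteinProjective.of_epi {f : N →ₗ[S] E} {g : E →ₗ[S] H} (h : IsSES f g)
    (hE : IsGorensteinProjective S E) (hH : IsGorensteinProjective S H) :
    IsGorensteinProjective S N := by
  refine isGorensteinProjective_of_class (fun X => IsGorensteinProjective S X ∨
    X = ModuleCat.of S N) ?_ (ModuleCat.of S N) (Or.inr rfl)
  rintro X (hX | rfl)
  · refine ⟨hX.extVanish, ?_⟩
    obtain ⟨P, Y, i, p, hP, hip, hY⟩ := hX.exists_embedding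
    exact ⟨P, Y, i, p, hP, hip, Or.inl hY⟩
  refine ⟨ExtVanish.of_epi h hE.extVanish hH.extVanish, ?_⟩
  obtain ⟨P, Y, i, p, hP, hip, hY⟩ := hE.exists_embedding
  have hc : IsSES (i ∘ₗ f) (LinearMap.range (i ∘ₗ f)).mkQ := isSES_mkQ (hip.inj.comp h.inj)
  obtain ⟨a, ha⟩ := h.exists_factor ((LinearMap.range (i ∘ₗ f)).mkQ ∘ₗ i) (fun x => by
    rw [LinearMap.comp_apply]
    exact hc.g_comp_f_apply x)
  obtain ⟨b, hb⟩ := hc.exists_factor p (fun x => by simp [hip.g_comp_f_apply])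
  refine ⟨P, ModuleCat.of S (P ⧸ LinearMap.range (i ∘ₗ f)), i ∘ₗ f, _, hP, hc, Or.inl ?_⟩
  refine IsGorensteinProjective.of_extension (f := a) (g := b) ⟨?_, ?_, ?_⟩ hH hY
  · rw [injective_iff_map_eq_zero]
    intro x hx
    obtain ⟨x, rfl⟩ := h.surj x
    rw [ha] at hx
    obtain ⟨y, hy⟩ := (hc.exact (i x)).1 hx
    rw [← hip.inj hy, h.g_comp_f_apply]
  · intro y
    obtain ⟨y, rfl⟩ := hc.surj y
    rw [hb]
    constructor
    · intro hy
      obtain ⟨z, rfl⟩ := (hip.exact y).1 hy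
      exact ⟨g z, ha z⟩
    · rintro ⟨z, hz⟩
      obtain ⟨z, rfl⟩ := h.surj z
      rw [ha, LinearMap.comp_apply] at hz
      rw [← hb, ← hz, hb, hip.g_comp_f_apply]
  · intro y
    obtain ⟨y, rfl⟩ := hip.surj y
    exact ⟨_, hb y⟩

lemma isSES_inl_snd : IsSES (LinearMap.inl S N H) (LinearMap.snd S N H) :=
  ⟨LinearMap.inl_injective, Function.Exact.inl_snd, LinearMap.snd_surjective⟩

lemma IsGorensteinProjective.prod (hN : IsGorensteinProjective S N)
    (hH : IsGorensteinProjective S H) : IsGorensteinProjective S (N × H) :=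
  IsGorensteinProjective.of_extension isSES_inl_snd hN hH

end Closure

/-! ## Gorenstein projective dimension along Gorenstein projective cokernels -/

section Dimension

variable {S : Type u} [Ring S]
variable {N E H M : Type u} [AddCommGroup N] [Module S N] [AddCommGroup M] [Module S M]
    [AddCommGroup E] [Module S E] [AddCommGroup H] [Module S H]

lemma hasGorensteinResolution_zero_iff :
    HasGorensteinResolution S 0 M ↔ IsGorensteinProjective S M := by
  constructor
  · rintro ⟨G, d, ε, hG, h0, -, hε, hs⟩
    have := h0 1 one_pos
    refine (hG 0 le_rfl).congr (LinearEquiv.ofBijective ε ⟨?_, hs⟩).symm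
    rw [injective_iff_map_eq_zero]
    intro x hx
    obtain ⟨y, rfl⟩ := (hε x).1 hx
    rw [Subsingleton.elim (α := G 1) y 0]
    exact map_zero (d 0)
  · intro hM
    refine ⟨fun i => match i with
        | 0 => ModuleCat.of S M
        | _ + 1 => ModuleCat.of S PUnit.{u + 1},
      fun i => 0, LinearMap.id, ?_, ?_, ?_, ?_, Function.surjective_id⟩
    · intro i hi
      obtain rfl : i = 0 := Nat.le_zero.1 hi
      exact hM
    · rintro (_ | i) hi
      · exact absurd hi (lt_irrefl 0)
      · exact inferInstanceAs (Subsingleton PUnit)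
    · exact fun i y => ⟨fun _ => ⟨0, Subsingleton.elim (α := PUnit) _ _⟩, fun _ => rfl⟩
    · intro y
      constructor
      · intro hy
        exact ⟨0, hy.symm⟩
      · rintro ⟨x, rfl⟩
        rfl

lemma hasGorensteinResolution_succ_iff {n : ℕ} :
    HasGorensteinResolution S (n + 1) M ↔
      ∃ (K G : ModuleCat.{u} S) (f : K →ₗ[S] G) (g : G →ₗ[S] M),
        IsSES f g ∧ IsGorensteinProjective S G ∧ HasGorensteinResolution S n K := by
  constructor
  · rintro ⟨G, d, ε, hG, h0, hd, hε, hs⟩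
    have hmem : ∀ x, d 0 x ∈ LinearMap.ker ε := fun x => hε.apply_apply_eq_zero x
    refine ⟨ModuleCat.of S (LinearMap.ker ε), G 0, _, ε, isSES_ker hs, hG 0 (Nat.zero_le _),
      fun i => G (i + 1), fun i => d (i + 1), (d 0).codRestrict _ hmem,
      fun i hi => hG _ (by lia), fun i hi => h0 _ (by lia), fun i => hd _, fun y => ?_, ?_⟩
    · rw [← hd 0 y, Subtype.ext_iff]
      rfl
    · rintro ⟨y, hy⟩
      obtain ⟨x, rfl⟩ := (hε y).1 hy
      exact ⟨x, rfl⟩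
  · rintro ⟨K, G₀, f, g, h, hG₀, G, d, ε, hG, h0, hd, hε, hs⟩
    refine ⟨fun i => match i with
        | 0 => G₀
        | i + 1 => G i,
      fun i => match i with
        | 0 => f ∘ₗ ε
        | i + 1 => d i, g, ?_, ?_, ?_, ?_, h.surj⟩
    · rintro (_ | i) hi
      · exact hG₀
      · exact hG i (by lia)
    · rintro (_ | i) hi
      · exact absurd hi (by lia)
      · exact h0 i (by lia)
    · rintro (_ | i)
      · intro y
        refine Iff.trans ⟨fun hy => ?_, fun hy => ?_⟩ (hε y)
        · exact h.inj (hy.trans (map_zero f).symm)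
        · exact (congrArg f hy).trans (map_zero f)
      · exact hd i
    · intro y
      refine (h.exact y).trans ⟨?_, ?_⟩
      · rintro ⟨x, rfl⟩
        obtain ⟨x, rfl⟩ := hs x
        exact ⟨x, rfl⟩
      · rintro ⟨x, rfl⟩
        exact ⟨_, rfl⟩

/-- Replace the first term `G` of a resolution of `E` by the kernel of `G → E → H`, which is still
Gorenstein projective; the first syzygy `K` is unchanged. -/
lemma HasGorensteinResolution.of_middle {n : ℕ} {f : N →ₗ[S] E} {g : E →ₗ[S] H} (h : IsSES f g)
    (hH : IsGorensteinProjective S H) (hE : HasGorensteinResolution S n E) :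
    HasGorensteinResolution S n N := by
  rcases n with _ | n
  · rw [hasGorensteinResolution_zero_iff] at hE ⊢
    exact IsGorensteinProjective.of_epi h hE hH
  · rw [hasGorensteinResolution_succ_iff] at hE ⊢
    obtain ⟨K, G, i, p, hip, hG, hK⟩ := hE
    have hk := isSES_ker (g := g ∘ₗ p) (h.surj.comp hip.surj)
    have hmem : ∀ x, i x ∈ LinearMap.ker (g ∘ₗ p) := fun x => by simp [hip.g_comp_f_apply]
    obtain ⟨q, hq⟩ : ∃ q : LinearMap.ker (g ∘ₗ p) →ₗ[S] N, ∀ x, f (q x) = p x := by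
      have hr : ∀ x : LinearMap.ker (g ∘ₗ p), p x ∈ LinearMap.range f :=
        fun x => (h.exact _).1 x.2
      refine ⟨(LinearEquiv.ofInjective f h.inj).symm.toLinearMap ∘ₗ
        (p ∘ₗ Submodule.subtype _).codRestrict _ hr, fun x => ?_⟩
      exact congrArg Subtype.val ((LinearEquiv.ofInjective f h.inj).apply_symm_apply ⟨p x, hr x⟩)
    refine ⟨K, ModuleCat.of S (LinearMap.ker (g ∘ₗ p)), i.codRestrict _ hmem, q,
      ⟨fun x y hxy => hip.inj (congrArg Subtype.val hxy), fun y => ?_, fun y => ?_⟩,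
      IsGorensteinProjective.of_epi hk hG hH, hK⟩
    · rw [← map_eq_zero_iff f h.inj, hq]
      refine (hip.exact y.1).trans ⟨?_, ?_⟩
      · rintro ⟨x, hx⟩
        exact ⟨x, Subtype.ext hx⟩
      · rintro ⟨x, hx⟩
        exact ⟨x, congrArg Subtype.val hx⟩
    · obtain ⟨x, hx⟩ := hip.surj (f y)
      refine ⟨⟨x, by simp [hx, h.g_comp_f_apply]⟩, h.inj ?_⟩
      rw [hq, hx]

/-- Lift a projective cover term `P → H` to `E`, so that `G × P` maps onto `E`. The kernel sits in
`0 → K → ker c → L → 0` with `L` Gorenstein projective, which is the same situation one step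
shorter. -/
lemma HasGorensteinResolution.of_left {n : ℕ} {f : N →ₗ[S] E} {g : E →ₗ[S] H} (h : IsSES f g)
    (hH : IsGorensteinProjective S H) (hN : HasGorensteinResolution S n N) :
    HasGorensteinResolution S n E := by
  induction n generalizing N E H with
  | zero =>
    rw [hasGorensteinResolution_zero_iff] at hN ⊢
    exact IsGorensteinProjective.of_extension h hN hH
  | succ n ih =>
    rw [hasGorensteinResolution_succ_iff] at hN ⊢
    obtain ⟨K, G, i, p, hip, hG, hK⟩ := hN
    obtain ⟨L, P, j, q, hP, hjq, hL⟩ := hH.exists_cover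
    obtain ⟨l, hl⟩ := Module.projective_lifting_property g q h.surj
    have hl : ∀ x, g (l x) = q x := fun x => LinearMap.congr_fun hl x
    let c : G × P →ₗ[S] E := (f ∘ₗ p).coprod l
    have hc : Function.Surjective c := by
      intro e
      obtain ⟨y, hy⟩ := hjq.surj (g e)
      obtain ⟨n, hn⟩ := (h.exact (e - l y)).1 (by rw [map_sub, hl, hy, sub_self])
      obtain ⟨x, rfl⟩ := hip.surj n
      exact ⟨(x, y), by simp [c, hn]⟩
    refine ⟨ModuleCat.of S (LinearMap.ker c), ModuleCat.of S (G × P), _, c, isSES_ker hc,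
      hG.prod IsGorensteinProjective.of_projective, ?_⟩
    have hmem : ∀ x, LinearMap.inl S G P (i x) ∈ LinearMap.ker c := fun x => by
      simp [c, hip.g_comp_f_apply]
    obtain ⟨r, hr⟩ : ∃ r : LinearMap.ker c →ₗ[S] L, ∀ x, j (r x) = x.1.2 := by
      have hr : ∀ x : LinearMap.ker c, x.1.2 ∈ LinearMap.range j := by
        rintro ⟨⟨x, y⟩, hxy⟩
        refine (hjq.exact y).1 ?_
        have := congrArg g (LinearMap.mem_ker.1 hxy)
        simpa [c, h.g_comp_f_apply, hl] using this
      refine ⟨(LinearEquiv.ofInjective j hjq.inj).symm.toLinearMap ∘ₗ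
        (LinearMap.snd S G P ∘ₗ Submodule.subtype _).codRestrict _ hr, fun x => ?_⟩
      exact congrArg Subtype.val
        ((LinearEquiv.ofInjective j hjq.inj).apply_symm_apply ⟨x.1.2, hr x⟩)
    refine ih (f := (LinearMap.inl S G P ∘ₗ i).codRestrict _ hmem) (g := r) ⟨?_, ?_, ?_⟩ hL hK
    · exact fun x y hxy => hip.inj (congrArg (fun z => z.1.1) hxy)
    · intro z
      rw [← map_eq_zero_iff j hjq.inj, hr]
      constructor
      · intro hz
        have h0 : f (p z.1.1) = 0 := by
          have h0 : f (p z.1.1) + l z.1.2 = 0 := z.2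
          rwa [hz, map_zero, add_zero] at h0
        obtain ⟨x, hx⟩ := (hip.exact _).1 (h.inj (h0.trans (map_zero f).symm))
        exact ⟨x, Subtype.ext (Prod.ext hx hz.symm)⟩
      · rintro ⟨x, rfl⟩
        rfl
    · intro y
      obtain ⟨n, hn⟩ := (h.exact (l (j y))).1 (by rw [hl, hjq.g_comp_f_apply])
      obtain ⟨x, rfl⟩ := hip.surj n
      refine ⟨⟨(-x, j y), by simp [c, hn]⟩, hjq.inj ?_⟩
      rw [hr]

lemma Gpd_eq_of_isSES {f : N →ₗ[S] E} {g : E →ₗ[S] H} (h : IsSES f g)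
    (hH : IsGorensteinProjective S H) : Gpd S N = Gpd S E := by
  have : ∀ n, HasGorensteinResolution S n N ↔ HasGorensteinResolution S n E := fun n =>
    ⟨HasGorensteinResolution.of_left h hH, HasGorensteinResolution.of_middle h hH⟩
  simp only [Gpd, this]

end Dimension

/-! ### Ext along monomorphisms with Ext-acyclic cokernel -/

section ExtIso

variable (S T D : Type u) [Ring S] [Ring T] [AddCommGroup D] [Module S D] [Module T D]
  [SMulCommClass S T D]
variable {N E H : Type u} [AddCommGroup N] [Module S N]
    [AddCommGroup E] [Module S E] [AddCommGroup H] [Module S H]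

/-- A monomorphism whose cokernel has vanishing Ext induces isomorphisms on Ext. -/
lemma ExtVanish.nonempty_extEquiv [hD : Module.Projective S D] {f : N →ₗ[S] E} {g : E →ₗ[S] H}
    (h : IsSES f g) (hH : ExtVanish S H) {i : ℕ} (hi : 1 ≤ i) :
    Nonempty (ExtD S D E i ≃ₗ[T] ExtD S D N i) := by
  -- The cokernel's Ext must vanish in degrees `i` and `i + 1`, whence the exclusion of degree zero.
  obtain ⟨i, rfl⟩ := Nat.exists_eq_add_of_le' hi
  have := hH (ModuleCat.of S D) hD i
  have := hH (ModuleCat.of S D) hD (i + 1)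
  let φ : ExtD S D E (i + 1) →ₗ[T] ExtD S D N (i + 1) :=
    { toFun := fun x => (Abelian.Ext.mk₀ (ModuleCat.ofHom f)).comp x (zero_add _)
      map_add' := fun x y => Abelian.Ext.comp_add _ _ _ _
      map_smul' := fun t x => (Abelian.Ext.comp_assoc _ x
        (Abelian.Ext.mk₀ (mulHom S T D t)) (zero_add _) (add_zero _) (by simp)).symm }
  refine ⟨LinearEquiv.ofBijective φ ⟨?_, fun x => ?_⟩⟩
  · rw [injective_iff_map_eq_zero]
    intro x hx
    obtain ⟨y, rfl⟩ := Abelian.Ext.contravariant_sequence_exact₂ h.shortExact _ x hx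
    rw [Subsingleton.elim (α := Abelian.Ext.{u} (ModuleCat.of S H) (ModuleCat.of S D) (i + 1)) y 0]
    exact Abelian.Ext.comp_zero (Abelian.Ext.mk₀ h.complex.g) _ _ _ _
  · exact Abelian.Ext.contravariant_sequence_exact₁ h.shortExact (ModuleCat.of S D) x
      (add_comm 1 (i + 1)) (Subsingleton.elim (α := Abelian.Ext.{u} (ModuleCat.of S H)
        (ModuleCat.of S D) (i + 1 + 1)) _ _)

end ExtIso

/-! ## Finitely generated Gorenstein projective modules -/

section Finite

variable {S : Type u} [Ring S]

/-- A map from a finitely generated module to a projective module factors through a finite free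
module. -/
lemma exists_factor_finite_free {K Q : Type u} [AddCommGroup K] [Module S K] [Module.Finite S K]
    [AddCommGroup Q] [Module S Q] [Module.Projective S Q] (h : K →ₗ[S] Q) :
    ∃ (ι : Type u) (_ : Fintype ι) (a : Q →ₗ[S] (ι → S)) (b : (ι → S) →ₗ[S] Q),
      ∀ k, b (a (h k)) = h k := by
  classical
  obtain ⟨σ, hσ⟩ := (Module.projective_def' (R := S) (P := Q)).1 inferInstance
  obtain ⟨t, ht⟩ := Module.Finite.fg_top (R := S) (M := K)
  -- The finite free module has the finitely many coordinates that the section `σ` uses on the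
  -- images of the generators.
  let s : Finset Q := t.biUnion fun k => (σ (h k)).support
  refine ⟨s, inferInstance, LinearMap.pi fun i => Finsupp.lapply i.1 ∘ₗ σ,
    Fintype.linearCombination S (fun i : s => i.1), ?_⟩
  refine LinearMap.congr_fun (f := Fintype.linearCombination S (fun i : s => i.1) ∘ₗ
    (LinearMap.pi fun i => Finsupp.lapply i.1 ∘ₗ σ) ∘ₗ h) (LinearMap.ext_on ht fun k hk => ?_)
  have hs : (σ (h k)).support ⊆ s := Finset.subset_biUnion_of_mem
    (fun k => (σ (h k)).support) hk
  have h1 := LinearMap.congr_fun hσ (h k)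
  rw [LinearMap.comp_apply, Finsupp.linearCombination_apply,
    Finsupp.sum_of_support_subset _ hs _ (by simp)] at h1
  simp only [LinearMap.comp_apply, Fintype.linearCombination_apply, LinearMap.pi_apply,
    Finsupp.lapply_apply]
  rw [Finset.sum_coe_sort s (fun i => (σ (h k)) i • i)]
  exact h1

/-- A finitely generated Gorenstein projective module embeds into a finite free module with
Gorenstein projective cokernel. -/
lemma IsGorensteinProjective.exists_finite_embedding {X : Type u} [AddCommGroup X] [Module S X]
    [Module.Finite S X] (hX : IsGorensteinProjective S X) :
    ∃ (ι : Type u) (_ : Fintype ι) (C : ModuleCat.{u} S) (f : X →ₗ[S] (ι → S))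
      (g : (ι → S) →ₗ[S] C), IsSES f g ∧ Module.Finite S C ∧ IsGorensteinProjective S C := by
  obtain ⟨P, H, j, p, hP, h, hH⟩ := hX.exists_embedding
  obtain ⟨ι, _, a, b, hab⟩ := exists_factor_finite_free j
  have hf : Function.Injective (a ∘ₗ j) := by
    intro x y hxy
    apply h.inj
    rw [← hab x, ← hab y]
    exact congrArg b hxy
  have hc := isSES_mkQ hf
  refine ⟨ι, inferInstance, ModuleCat.of S ((ι → S) ⧸ LinearMap.range (a ∘ₗ j)), a ∘ₗ j, _, hc,
    inferInstanceAs (Module.Finite S ((ι → S) ⧸ LinearMap.range (a ∘ₗ j))), ?_⟩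
  -- A dual Schanuel argument: `u` and `v` are surjections with the same kernel, the copy `z ↦ (-a
  -- (j z), j z)` of `X`. So `C × P ≅ (ι → S) × H`, with `C` the cokernel of `a ∘ₗ j`; then `C` is
  -- the kernel of the projection onto `P`.
  let u : (ι → S) × P →ₗ[S] (ι → S) × H :=
    (LinearMap.fst S _ _ + a ∘ₗ LinearMap.snd S _ _).prod (p ∘ₗ LinearMap.snd S _ _)
  let v : (ι → S) × P →ₗ[S] ((ι → S) ⧸ LinearMap.range (a ∘ₗ j)) × P :=
    ((LinearMap.range (a ∘ₗ j)).mkQ ∘ₗ LinearMap.fst S _ _).prod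
      (LinearMap.snd S _ _ + b ∘ₗ LinearMap.fst S _ _)
  have hu : Function.Surjective u := by
    rintro ⟨x, y⟩
    obtain ⟨y, rfl⟩ := h.surj y
    exact ⟨(x - a y, y), by simp [u]⟩
  have hv : Function.Surjective v := by
    rintro ⟨x, y⟩
    obtain ⟨x, rfl⟩ := hc.surj x
    exact ⟨(x, y - b x), by simp [v]⟩
  have huv : LinearMap.ker u = LinearMap.ker v := by
    ext ⟨x, y⟩
    simp only [LinearMap.mem_ker, u, v, LinearMap.prod_apply, Function.prod, Prod.mk_eq_zero,
      LinearMap.add_apply, LinearMap.comp_apply, LinearMap.fst_apply, LinearMap.snd_apply]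
    constructor
    · rintro ⟨h1, h2⟩
      obtain ⟨z, rfl⟩ := (h.exact y).1 h2
      rw [eq_neg_of_add_eq_zero_left h1]
      refine ⟨?_, by rw [map_neg, hab, add_neg_cancel]⟩
      rw [map_neg, neg_eq_zero]
      exact hc.g_comp_f_apply z
    · rintro ⟨h1, h2⟩
      obtain ⟨z, rfl⟩ := (hc.exact x).1 h1
      rw [LinearMap.comp_apply, hab] at h2
      rw [eq_neg_of_add_eq_zero_left h2]
      exact ⟨by simp, by rw [map_neg, h.g_comp_f_apply, neg_zero]⟩
  have e : (((ι → S) ⧸ LinearMap.range (a ∘ₗ j)) × P) ≃ₗ[S] (ι → S) × H :=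
    (v.quotKerEquivOfSurjective hv).symm.trans
      ((Submodule.quotEquivOfEq _ _ huv.symm).trans (u.quotKerEquivOfSurjective hu))
  have hprod := ((IsGorensteinProjective.of_projective (S := S) (E := ι → S)).prod hH).congr e
  exact IsGorensteinProjective.of_epi isSES_inl_snd hprod IsGorensteinProjective.of_projective

end Finite

/-! ## Duality -/

section Duality

variable (S T D : Type u) [Ring S] [Ring T] [AddCommGroup D] [Module S D] [Module T D]

/-- The bimodule `D` is free of rank one on both sides, and the two rings are the endomorphism
rings of each other. -/
structure IsDualizing : Prop where
  left : Nonempty (D ≃ₗ[S] S)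
  right : Nonempty (D ≃ₗ[T] T)
  left_surj : ∀ φ : D →ₗ[T] D, ∃ s : S, ∀ x, φ x = s • x
  right_surj : ∀ φ : D →ₗ[S] D, ∃ t : T, ∀ x, φ x = t • x

variable {S T D}

lemma IsDualizing.symm (h : IsDualizing S T D) : IsDualizing T S D :=
  ⟨h.right, h.left, h.right_surj, h.left_surj⟩

lemma IsDualizing.projective_left (h : IsDualizing S T D) : Module.Projective S D := by
  obtain ⟨e⟩ := h.left
  exact Module.Projective.of_equiv e.symm

lemma IsDualizing.finite_left (h : IsDualizing S T D) : Module.Finite S D := by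
  obtain ⟨e⟩ := h.left
  exact Module.Finite.equiv e.symm

variable {X Y Z : Type u} [AddCommGroup X] [Module S X] [AddCommGroup Y] [Module S Y]
  [AddCommGroup Z] [Module S Z]

/-- If all maps from a finitely generated module to `D` extend, so do all maps to projective
modules. -/
lemma IsDualizing.extend_of_extend (hD : IsDualizing S T D) [Module.Finite S X] (f : X →ₗ[S] Y)
    (hf : ∀ k : X →ₗ[S] D, ∃ l : Y →ₗ[S] D, ∀ x, l (f x) = k x)
    [Module.Projective S Z] (k : X →ₗ[S] Z) : ∃ l : Y →ₗ[S] Z, ∀ x, l (f x) = k x := by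
  obtain ⟨e⟩ := hD.left
  obtain ⟨ι, _, a, b, hab⟩ := exists_factor_finite_free k
  choose l hl using fun i => hf (e.symm.toLinearMap ∘ₗ LinearMap.proj i ∘ₗ a ∘ₗ k)
  refine ⟨b ∘ₗ LinearMap.pi fun i => e.toLinearMap ∘ₗ l i, fun x => ?_⟩
  rw [← hab, LinearMap.comp_apply]
  congr 1
  ext i
  simp [hl]

variable [SMulCommClass S T D]

@[simp]
lemma dualMap_apply (f : X →ₗ[S] Y) (h : Y →ₗ[S] D) (x : X) : dualMap S T D f h x = h (f x) :=
  rfl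

lemma IsSES.dual [Module.Projective S D] {f : X →ₗ[S] Y} {g : Y →ₗ[S] Z} (h : IsSES f g)
    (hZ : ExtVanish S Z) : IsSES (dualMap S T D g) (dualMap S T D f) := by
  refine ⟨fun a b hab => ?_, fun k => ⟨fun hk => ?_, ?_⟩, fun k => ?_⟩
  · ext z
    obtain ⟨y, rfl⟩ := h.surj z
    exact LinearMap.congr_fun hab y
  · obtain ⟨l, hl⟩ := h.exists_factor k (fun x => LinearMap.congr_fun hk x)
    exact ⟨l, LinearMap.ext hl⟩
  · rintro ⟨l, rfl⟩
    ext x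
    simp [h.g_comp_f_apply]
  · obtain ⟨l, hl⟩ := ExtVanish.extend h hZ k
    exact ⟨l, LinearMap.ext hl⟩

variable (S T D) in
/-- The dual of a finite free module. -/
noncomputable def dualFreeEquiv (ι : Type u) [Fintype ι] :
    (ι → D) ≃ₗ[T] ((ι → S) →ₗ[S] D) :=
  (Pi.basisFun S ι).constr T

lemma IsDualizing.projective_dual_free (h : IsDualizing S T D) (ι : Type u) [Fintype ι] :
    Module.Projective T ((ι → S) →ₗ[S] D) := by
  obtain ⟨e⟩ := h.right
  exact Module.Projective.of_equiv
    ((LinearEquiv.piCongrRight fun _ : ι => e.symm).trans (dualFreeEquiv S T D ι))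

lemma IsDualizing.finite_dual_free (h : IsDualizing S T D) (ι : Type u) [Fintype ι] :
    Module.Finite T ((ι → S) →ₗ[S] D) := by
  have := h.symm.finite_left
  exact Module.Finite.equiv (dualFreeEquiv S T D ι)

/-- Dualizing an embedding into a finite free module makes the dual of `X` a quotient of a finitely
generated module. -/
lemma IsDualizing.finite_dual (hD : IsDualizing S T D) [Module.Finite S X]
    (hX : IsGorensteinProjective S X) : Module.Finite T (X →ₗ[S] D) := by
  have := hD.projective_left
  obtain ⟨ι, _, C, f, g, h, -, hC⟩ := hX.exists_finite_embedding
  have := hD.finite_dual_free ι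
  exact Module.Finite.of_surjective _ (h.dual (T := T) (D := D) hC.extVanish).surj

variable [SMulCommClass T S D]

variable (S T D X) in
/-- The evaluation map into the bidual. -/
def evalMap : X →ₗ[S] ((X →ₗ[S] D) →ₗ[T] D) where
  toFun x :=
    { toFun := fun h => h x
      map_add' := fun _ _ => rfl
      map_smul' := fun _ _ => rfl }
  map_add' x y := by
    ext h
    exact map_add h x y
  map_smul' s x := by
    ext h
    exact map_smul h s x

@[simp]
lemma evalMap_apply (x : X) (h : X →ₗ[S] D) : evalMap S T D X x h = h x :=
  rfl

/-- Coordinatewise this is the rank one case, where surjectivity is the statement that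
`T`-endomorphisms of `D` come from `S`. -/
lemma IsDualizing.bijective_evalMap_free (hD : IsDualizing S T D) (ι : Type u) [Fintype ι] :
    Function.Bijective (evalMap S T D (ι → S)) := by
  classical
  obtain ⟨e⟩ := hD.left
  constructor
  · rw [injective_iff_map_eq_zero]
    intro x hx
    ext i
    have := LinearMap.congr_fun hx (e.symm.toLinearMap ∘ₗ LinearMap.proj i)
    simpa using this
  · intro φ
    let c : ι → D →ₗ[T] ((ι → S) →ₗ[S] D) := fun i =>
      { toFun := fun d => (LinearMap.toSpanSingleton S D d) ∘ₗ LinearMap.proj i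
        map_add' := fun d d' => by
          ext
          simp [LinearMap.toSpanSingleton_apply]
        map_smul' := fun t d => LinearMap.ext fun x => smul_comm (x i) t d }
    choose s hs using fun i => hD.left_surj (φ ∘ₗ c i)
    refine ⟨s, ?_⟩
    ext h
    have hsum : h = ∑ i, c i (h (Pi.single i 1)) := by
      ext i
      simp only [c, LinearMap.comp_apply, LinearMap.coe_sum, Finset.sum_apply]
      rw [Finset.sum_eq_single i]
      · simp
      · intro j _ hj
        simp [hj]
      · simp
    rw [evalMap_apply]
    conv_rhs => rw [hsum, map_sum]
    conv_lhs => rw [pi_eq_sum_univ s, map_sum]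
    refine Finset.sum_congr rfl fun i _ => ?_
    rw [map_smul]
    exact (congrArg (fun z => s i • h z) (by ext j; simp [Pi.single_apply, eq_comm])).trans
      (hs i (h (Pi.single i 1))).symm

lemma IsDualizing.injective_evalMap (hD : IsDualizing S T D) [Module.Finite S X]
    (hX : IsGorensteinProjective S X) : Function.Injective (evalMap S T D X) := by
  obtain ⟨ι, _, C, f, g, h, -, -⟩ := hX.exists_finite_embedding
  rw [injective_iff_map_eq_zero]
  intro x hx
  refine h.inj (((hD.bijective_evalMap_free ι).1 ?_).trans (map_zero f).symm)
  rw [map_zero]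
  ext k
  exact LinearMap.congr_fun hx (k ∘ₗ f)

/-- Finitely generated Gorenstein projective modules are reflexive. -/
lemma IsDualizing.bijective_evalMap (hD : IsDualizing S T D) [Module.Finite S X]
    (hX : IsGorensteinProjective S X) : Function.Bijective (evalMap S T D X) := by
  have := hD.projective_left
  refine ⟨hD.injective_evalMap hX, fun φ => ?_⟩
  obtain ⟨ι, _, C, f, g, h, hCf, hC⟩ := hX.exists_finite_embedding
  -- Transported to the free module, `φ` is evaluation at some `x`. Every functional on `C` kills `g
  -- x`, and `C` embeds into its bidual, so `x` comes from `X`.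
  obtain ⟨x, hx⟩ := (hD.bijective_evalMap_free ι).2 (φ ∘ₗ dualMap S T D f)
  have hgx : g x = 0 := by
    refine hD.injective_evalMap hC ?_
    rw [map_zero]
    ext k
    refine (LinearMap.congr_fun hx (k ∘ₗ g)).trans ?_
    have : dualMap S T D f (k ∘ₗ g) = 0 := by
      ext x
      simp [h.g_comp_f_apply]
    rw [LinearMap.comp_apply, this, map_zero, LinearMap.zero_apply]
  obtain ⟨y, rfl⟩ := (h.exact x).1 hgx
  refine ⟨y, ?_⟩
  ext k
  obtain ⟨l, rfl⟩ := (h.dual (T := T) (D := D) hC.extVanish).surj k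
  exact LinearMap.congr_fun hx l

/-- Duals of finitely generated Gorenstein projectives are closed under syzygies: `X → S^ι → C`
dualizes to `C^* → (S^ι)^* → X^*`. By reflexivity a functional on `C^*` is evaluation at some `c`,
and evaluation at a preimage of `c` in `S^ι` extends it. -/
lemma IsDualizing.extVanish_dual (hD : IsDualizing S T D) [Module.Finite S X]
    (hX : IsGorensteinProjective S X) : ExtVanish T (X →ₗ[S] D) := by
  have := hD.projective_left
  refine ExtVanish.of_class (fun Y => ∃ X : ModuleCat.{u} S, Module.Finite S X ∧
    IsGorensteinProjective S X ∧ Nonempty (Y ≃ₗ[T] (X →ₗ[S] D))) ?_ (ModuleCat.of T (X →ₗ[S] D))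
    ⟨ModuleCat.of S X, ‹_›, hX, ⟨LinearEquiv.refl _ _⟩⟩
  clear! X
  rintro Y ⟨X, hXf, hX, ⟨e⟩⟩
  obtain ⟨ι, _, C, f, g, h, hCf, hC⟩ := hX.exists_finite_embedding
  have hd := h.dual (T := T) (D := D) hC.extVanish
  refine ⟨ModuleCat.of T (C →ₗ[S] D), ModuleCat.of T ((ι → S) →ₗ[S] D), dualMap S T D g,
    e.symm.toLinearMap ∘ₗ dualMap S T D f, hD.projective_dual_free ι,
    ⟨hd.inj, fun y => ?_, e.symm.surjective.comp hd.surj⟩,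
    ⟨C, hCf, hC, ⟨LinearEquiv.refl _ _⟩⟩, fun Q hQ k => ?_⟩
  · simpa using hd.exact y
  · have := hD.finite_dual hC
    refine hD.symm.extend_of_extend (dualMap S T D g) (fun k => ?_) k
    obtain ⟨c, rfl⟩ := (hD.bijective_evalMap hC).2 k
    obtain ⟨x, rfl⟩ := h.surj c
    exact ⟨evalMap S T D _ x, fun l => rfl⟩

/-- The dual of a finitely generated Gorenstein projective module is Gorenstein projective. -/
lemma IsDualizing.isGorensteinProjective_dual [IsNoetherianRing S] (hD : IsDualizing S T D)
    [Module.Finite S X] (hX : IsGorensteinProjective S X) :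
    IsGorensteinProjective T (X →ₗ[S] D) := by
  have := hD.projective_left
  refine isGorensteinProjective_of_class (fun Y => ∃ X : ModuleCat.{u} S, Module.Finite S X ∧
    IsGorensteinProjective S X ∧ Nonempty (Y ≃ₗ[T] (X →ₗ[S] D))) ?_ (ModuleCat.of T (X →ₗ[S] D))
    ⟨ModuleCat.of S X, ‹_›, hX, ⟨LinearEquiv.refl _ _⟩⟩
  clear! X
  rintro Y ⟨X, hXf, hX, ⟨e⟩⟩
  constructor
  · exact ExtVanish.of_epi (f := e.toLinearMap) (g := (0 : _ →ₗ[T] PUnit.{u + 1}))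
      ⟨e.injective, fun y => ⟨fun _ => e.surjective y, fun _ => rfl⟩, fun y => ⟨0, rfl⟩⟩
      (hD.extVanish_dual hX) ExtVanish.of_projective
  -- Dualizing a finite free cover of `X` embeds its dual into a projective; the Noetherian
  -- hypothesis keeps the kernel of the cover finitely generated.
  · obtain ⟨n, g, hg⟩ := Module.Finite.exists_fin' S X
    have hg' : Function.Surjective (g ∘ₗ
        (LinearEquiv.funCongrLeft S S (Equiv.ulift.{u} (α := Fin n)).symm).toLinearMap) :=
      hg.comp (LinearEquiv.surjective _)
    have h := isSES_ker hg'
    have hd := h.dual (T := T) (D := D) hX.extVanish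
    refine ⟨ModuleCat.of T ((ULift.{u} (Fin n) → S) →ₗ[S] D), ModuleCat.of T (_ →ₗ[S] D),
      dualMap S T D _ ∘ₗ e.toLinearMap, _, hD.projective_dual_free _,
      ⟨hd.inj.comp e.injective, fun y => ?_, hd.surj⟩,
      ModuleCat.of S _, inferInstanceAs (Module.Finite S (LinearMap.ker _)),
      IsGorensteinProjective.of_epi h IsGorensteinProjective.of_projective hX,
      ⟨LinearEquiv.refl _ _⟩⟩
    refine (hd.exact y).trans ⟨?_, ?_⟩
    · rintro ⟨x, rfl⟩
      exact ⟨e.symm x, by simp⟩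
    · rintro ⟨x, rfl⟩
      exact ⟨e x, rfl⟩

end Duality

/-! ## Comparison of Gorenstein transposes -/

section Comparison

variable {S T D : Type u} [Ring S] [Ring T] [AddCommGroup D] [Module S D] [Module T D]
  [SMulCommClass S T D]

lemma IsTranspose.isGorensteinTranspose {A M : Type u} [AddCommGroup A] [Module S A]
    [AddCommGroup M] [Module T M] (h : IsTranspose S T D A M) :
    IsGorensteinTranspose S T D A M := by
  obtain ⟨P₁, P₀, f, p, hf₁, hf₀, hP₁, hP₀, h⟩ := h
  exact ⟨P₁, P₀, f, p, hf₁, hf₀, .of_projective, .of_projective, h⟩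

variable (S T D) in
/-- Finitely generated modules have transposes. -/
lemma exists_isTranspose [IsNoetherianRing S] (A : Type u) [AddCommGroup A] [Module S A]
    [Module.Finite S A] : ∃ M : ModuleCat.{u} T, IsTranspose S T D A M := by
  obtain ⟨n, p, hp⟩ := Module.Finite.exists_fin' S A
  obtain ⟨m, q, hq⟩ := Module.Finite.exists_fin' S (LinearMap.ker p)
  refine ⟨ModuleCat.of T (((Fin m → S) →ₗ[S] D) ⧸
      LinearMap.range (dualMap S T D ((LinearMap.ker p).subtype ∘ₗ q))),
    ModuleCat.of S (Fin m → S), ModuleCat.of S (Fin n → S), (LinearMap.ker p).subtype ∘ₗ q, p,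
    inferInstanceAs (Module.Finite S (Fin m → S)), inferInstanceAs (Module.Finite S (Fin n → S)),
    inferInstanceAs (Module.Projective S (Fin m → S)),
    inferInstanceAs (Module.Projective S (Fin n → S)), fun y => ⟨fun hy => ?_, ?_⟩, hp,
    ⟨LinearEquiv.refl _ _⟩⟩
  · obtain ⟨x, hx⟩ := hq ⟨y, hy⟩
    exact ⟨x, congrArg Subtype.val hx⟩
  · rintro ⟨x, rfl⟩
    exact (q x).2

variable [SMulCommClass T S D]

/-- Being a Gorenstein transpose is a symmetric relation. -/
lemma IsGorensteinTranspose.symm [IsNoetherianRing S] (hD : IsDualizing S T D)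
    {A M : Type u} [AddCommGroup A] [Module S A] [AddCommGroup M] [Module T M]
    (h : IsGorensteinTranspose S T D A M) : IsGorensteinTranspose T S D M A := by
  obtain ⟨X₁, X₀, g, p, hf₁, hf₀, h₁, h₀, hgp, hp, ⟨e⟩⟩ := h
  refine ⟨ModuleCat.of T (X₀ →ₗ[S] D), ModuleCat.of T (X₁ →ₗ[S] D), dualMap S T D g,
    e.symm.toLinearMap ∘ₗ (LinearMap.range (dualMap S T D g)).mkQ, hD.finite_dual h₀,
    hD.finite_dual h₁, hD.isGorensteinProjective_dual h₀, hD.isGorensteinProjective_dual h₁,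
    fun y => ?_, e.symm.surjective.comp (Submodule.mkQ_surjective _), ?_⟩
  · simp
  -- Under the evaluation isomorphisms the double dual of `g` is `g` itself, so its cokernel is `A`.
  · let q : X₀ →ₗ[S] ((X₀ →ₗ[S] D) →ₗ[T] D) ⧸ LinearMap.range (dualMap T S D (dualMap S T D g)) :=
      Submodule.mkQ _ ∘ₗ evalMap S T D X₀
    have hq : Function.Surjective q :=
      (Submodule.mkQ_surjective _).comp (hD.bijective_evalMap h₀).2
    have hpq : LinearMap.ker p = LinearMap.ker q := by
      ext x
      rw [LinearMap.mem_ker, hgp x, LinearMap.mem_ker, LinearMap.comp_apply, Submodule.mkQ_apply,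
        Submodule.Quotient.mk_eq_zero]
      constructor
      · rintro ⟨y, rfl⟩
        exact ⟨evalMap S T D X₁ y, rfl⟩
      · rintro ⟨φ, hφ⟩
        obtain ⟨y, rfl⟩ := (hD.bijective_evalMap h₁).2 φ
        exact ⟨y, (hD.bijective_evalMap h₀).1 hφ⟩
    exact ⟨(p.quotKerEquivOfSurjective hp).symm.trans
      ((Submodule.quotEquivOfEq _ _ hpq).trans (q.quotKerEquivOfSurjective hq))⟩

/-- A projective presentation dominating a Gorenstein projective one has a larger transpose, with
Gorenstein projective quotient. -/
lemma IsDualizing.exists_isSES_coker_dualMap [IsNoetherianRing S] (hD : IsDualizing S T D)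
    {Q₁ Q₀ Y₁ Y₀ : ModuleCat.{u} S} [Module.Finite S Q₁] [Module.Projective S Q₁]
    [Module.Projective S Q₀] (h₁ : IsGorensteinProjective S Y₁) (h₀ : IsGorensteinProjective S Y₀)
    (f : Q₁ →ₗ[S] Q₀) (g : Y₁ →ₗ[S] Y₀) (u₁ : Q₁ →ₗ[S] Y₁) (u₀ : Q₀ →ₗ[S] Y₀)
    (hcomm : ∀ x, u₀ (f x) = g (u₁ x)) (hu₀ : Function.Surjective u₀)
    (hpull : ∀ q y, u₀ q = g y → ∃ r, f r = q ∧ u₁ r = y) :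
    ∃ (C : ModuleCat.{u} T)
      (i : ((Y₁ →ₗ[S] D) ⧸ LinearMap.range (dualMap S T D g)) →ₗ[T]
        ((Q₁ →ₗ[S] D) ⧸ LinearMap.range (dualMap S T D f)))
      (p : ((Q₁ →ₗ[S] D) ⧸ LinearMap.range (dualMap S T D f)) →ₗ[T] C),
      IsSES i p ∧ IsGorensteinProjective T C := by
  have := hD.projective_left
  -- The kernel of `v` is the pullback of `Q₀` and `Y₁` over `Y₀`, and `hpull` says that `Q₁` maps
  -- onto it. The cokernel sought is the dual of the kernel of that map `w`.
  let v : Q₀ × Y₁ →ₗ[S] Y₀ := u₀.coprod (-g)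
  have hv : Function.Surjective v := fun y => by
    obtain ⟨x, rfl⟩ := hu₀ y
    exact ⟨(x, 0), by simp [v]⟩
  have hvses := isSES_ker hv
  have hZ : IsGorensteinProjective S (LinearMap.ker v) :=
    IsGorensteinProjective.of_epi hvses (IsGorensteinProjective.of_projective.prod h₁) h₀
  let w : Q₁ →ₗ[S] LinearMap.ker v := (f.prod u₁).codRestrict _ fun x => by simp [v, hcomm]
  have hw : Function.Surjective w := by
    rintro ⟨⟨q, y⟩, hqy⟩
    obtain ⟨r, rfl, rfl⟩ := hpull q y (by simpa [v, ← sub_eq_add_neg, sub_eq_zero] using hqy)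
    exact ⟨r, rfl⟩
  have hwses := isSES_ker hw
  have hu₁ : Function.Surjective u₁ := fun y => by
    obtain ⟨q, hq⟩ := hu₀ (g y)
    obtain ⟨r, -, rfl⟩ := hpull q y hq
    exact ⟨r, rfl⟩
  have hK : IsGorensteinProjective S (LinearMap.ker w) :=
    IsGorensteinProjective.of_epi hwses IsGorensteinProjective.of_projective hZ
  have hdual := hwses.dual (T := T) (D := D) hZ.extVanish
  let i : ((Y₁ →ₗ[S] D) ⧸ LinearMap.range (dualMap S T D g)) →ₗ[T]
      ((Q₁ →ₗ[S] D) ⧸ LinearMap.range (dualMap S T D f)) :=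
    Submodule.mapQ _ _ (dualMap S T D u₁) (by
      rintro _ ⟨k, rfl⟩
      refine ⟨k ∘ₗ u₀, ?_⟩
      ext x
      simp [hcomm])
  let p : ((Q₁ →ₗ[S] D) ⧸ LinearMap.range (dualMap S T D f)) →ₗ[T] (LinearMap.ker w →ₗ[S] D) :=
    Submodule.liftQ _ (dualMap S T D (LinearMap.ker w).subtype) (by
      rintro _ ⟨k, rfl⟩
      ext x
      have : f x = 0 := congrArg (fun z => z.1.1) x.2
      simp [this])
  refine ⟨ModuleCat.of T (LinearMap.ker w →ₗ[S] D), i, p, ⟨?_, ?_, ?_⟩,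
    hD.isGorensteinProjective_dual hK⟩
  · rw [injective_iff_map_eq_zero]
    intro a ha
    obtain ⟨a, rfl⟩ := Submodule.mkQ_surjective _ a
    obtain ⟨b, hb⟩ := (Submodule.Quotient.mk_eq_zero _).1 ha
    have hb : ∀ x, b (f x) = a (u₁ x) := LinearMap.congr_fun hb
    -- An element of `ker u₀` lifts to some `r` with `u₁ r = 0`, so `b` vanishes on it.
    obtain ⟨c, hc⟩ := (isSES_ker hu₀).exists_factor b (fun x => by
      obtain ⟨r, hr, hr'⟩ := hpull x.1 0 (x.2.trans (map_zero g).symm)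
      rw [Submodule.subtype_apply, ← hr, hb, hr', map_zero])
    refine (Submodule.Quotient.mk_eq_zero _).2 ⟨c, ?_⟩
    ext y
    obtain ⟨x, rfl⟩ := hu₁ y
    rw [dualMap_apply, ← hcomm, hc, hb]
  · intro y
    obtain ⟨δ, rfl⟩ := Submodule.mkQ_surjective _ y
    constructor
    · intro hδ
      -- A functional killing `ker w` descends to the pullback and extends to `Q₀ × Y₁`. Its `Q₀`
      -- part is absorbed by the range of the dual of `f`; its `Y₁` part is the preimage.
      obtain ⟨δ', rfl⟩ := (hdual.exact δ).1 hδ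
      obtain ⟨Δ, hΔ⟩ := ExtVanish.extend hvses h₀.extVanish δ'
      refine ⟨Submodule.mkQ _ (Δ ∘ₗ LinearMap.inr S Q₀ Y₁), ?_⟩
      refine (Submodule.Quotient.eq _).2 ⟨-(Δ ∘ₗ LinearMap.inl S Q₀ Y₁), ?_⟩
      ext x
      have h1 : δ' (w x) = Δ (f x, u₁ x) := (hΔ (w x)).symm
      have h2 : Δ (f x, u₁ x) = Δ (f x, 0) + Δ (0, u₁ x) := by simp [← map_add]
      simp [h1, h2]
    · rintro ⟨a, ha⟩
      obtain ⟨a, rfl⟩ := Submodule.mkQ_surjective _ a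
      rw [← ha]
      change dualMap S T D (LinearMap.ker w).subtype (dualMap S T D u₁ a) = 0
      ext x
      have : u₁ x = 0 := congrArg (fun z => z.1.2) x.2
      simp [this]
  · intro k
    obtain ⟨l, rfl⟩ := hdual.surj k
    exact ⟨Submodule.mkQ _ l, rfl⟩

/-- Two Gorenstein transposes of a module embed into a common module with Gorenstein projective
cokernels. -/
lemma IsGorensteinTranspose.exists_common_extension [IsNoetherianRing S] (hD : IsDualizing S T D)
    {B N N' : Type u} [AddCommGroup B] [Module S B] [AddCommGroup N] [Module T N]
    [AddCommGroup N'] [Module T N']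
    (h : IsGorensteinTranspose S T D B N) (h' : IsGorensteinTranspose S T D B N') :
    ∃ (E C C' : ModuleCat.{u} T) (i : N →ₗ[T] E) (p : E →ₗ[T] C) (i' : N' →ₗ[T] E)
      (p' : E →ₗ[T] C'), IsSES i p ∧ IsSES i' p' ∧
      IsGorensteinProjective T C ∧ IsGorensteinProjective T C' := by
  obtain ⟨X₁, X₀, g, p, hXf₁, hXf₀, hX₁, hX₀, hgp, hp, ⟨e⟩⟩ := h
  obtain ⟨Y₁, Y₀, g', p', hYf₁, hYf₀, hY₁, hY₀, hgp', hp', ⟨e'⟩⟩ := h'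
  let F : Submodule S (X₀ × Y₀) := LinearMap.ker (p.coprod (-p'))
  have hF : ∀ z, z ∈ F ↔ p z.1 = p' z.2 := fun z => by
    simp [F, ← sub_eq_add_neg, sub_eq_zero]
  obtain ⟨n, a, ha⟩ := Module.Finite.exists_fin' S F
  let u : (Fin n → S) →ₗ[S] X₀ := LinearMap.fst S _ _ ∘ₗ F.subtype ∘ₗ a
  let u' : (Fin n → S) →ₗ[S] Y₀ := LinearMap.snd S _ _ ∘ₗ F.subtype ∘ₗ a
  have hu : Function.Surjective u := fun x => by
    obtain ⟨y, hy⟩ := hp' (p x)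
    obtain ⟨z, hz⟩ := ha ⟨(x, y), (hF _).2 hy.symm⟩
    exact ⟨z, congrArg (fun w => w.1.1) hz⟩
  have hu' : Function.Surjective u' := fun y => by
    obtain ⟨x, hx⟩ := hp (p' y)
    obtain ⟨z, hz⟩ := ha ⟨(x, y), (hF _).2 hx⟩
    exact ⟨z, congrArg (fun w => w.1.2) hz⟩
  have huu' : ∀ z, p (u z) = p' (u' z) := fun z => (hF _).1 (a z).2
  -- Covering the simultaneous pullback along `g` and `g'` makes the free presentation dominate both
  -- given ones.
  let G : Submodule S ((Fin n → S) × (X₁ × Y₁)) := LinearMap.ker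
    ((u.coprod (-(g ∘ₗ LinearMap.fst S _ _))).prod (u'.coprod (-(g' ∘ₗ LinearMap.snd S _ _))))
  have hG : ∀ z, z ∈ G ↔ u z.1 = g z.2.1 ∧ u' z.1 = g' z.2.2 := fun z => by
    simp [G, ← sub_eq_add_neg, sub_eq_zero]
  obtain ⟨m, b, hb⟩ := Module.Finite.exists_fin' S G
  let f : (Fin m → S) →ₗ[S] (Fin n → S) := LinearMap.fst S _ _ ∘ₗ G.subtype ∘ₗ b
  let v : (Fin m → S) →ₗ[S] X₁ := LinearMap.fst S _ _ ∘ₗ LinearMap.snd S _ _ ∘ₗ G.subtype ∘ₗ b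
  let v' : (Fin m → S) →ₗ[S] Y₁ := LinearMap.snd S _ _ ∘ₗ LinearMap.snd S _ _ ∘ₗ G.subtype ∘ₗ b
  have hfin : Module.Finite S (ModuleCat.of S (Fin m → S)) :=
    inferInstanceAs (Module.Finite S (Fin m → S))
  have hproj : ∀ k, Module.Projective S (ModuleCat.of S (Fin k → S)) := fun k =>
    inferInstanceAs (Module.Projective S (Fin k → S))
  have := hproj m
  have := hproj n
  have hlift : ∀ q x y, u q = g x → u' q = g' y → ∃ r, f r = q ∧ v r = x ∧ v' r = y := by
    intro q x y hx hy
    obtain ⟨r, hr⟩ := hb ⟨(q, x, y), (hG _).2 ⟨hx, hy⟩⟩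
    exact ⟨r, congrArg (fun w => w.1.1) hr, congrArg (fun w => w.1.2.1) hr,
      congrArg (fun w => w.1.2.2) hr⟩
  obtain ⟨C, i, q, hiq, hC⟩ := hD.exists_isSES_coker_dualMap
    (Q₁ := ModuleCat.of S (Fin m → S)) (Q₀ := ModuleCat.of S (Fin n → S)) hX₁ hX₀ f g v u
    (fun x => ((hG _).1 (b x).2).1) hu (fun q x hx => by
      -- If `u q` is in the range of `g`, its image in `B` is zero, so `u' q` is in the range of
      -- `g'`. This supplies the missing coordinate of a point of `G`.
      obtain ⟨y, hy⟩ := (hgp' (u' q)).1 (by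
        rw [← huu']
        exact (congrArg p hx).trans (hgp.apply_apply_eq_zero x))
      obtain ⟨r, h1, h2, -⟩ := hlift q x y hx hy.symm
      exact ⟨r, h1, h2⟩)
  obtain ⟨C', i', q', hiq', hC'⟩ := hD.exists_isSES_coker_dualMap
    (Q₁ := ModuleCat.of S (Fin m → S)) (Q₀ := ModuleCat.of S (Fin n → S)) hY₁ hY₀ f g' v' u'
    (fun x => ((hG _).1 (b x).2).2) hu' (fun q y hy => by
      obtain ⟨x, hx⟩ := (hgp (u q)).1 (by
        rw [huu']
        exact (congrArg p' hy).trans (hgp'.apply_apply_eq_zero y))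
      obtain ⟨r, h1, -, h2⟩ := hlift q x y hx.symm hy
      exact ⟨r, h1, h2⟩)
  refine ⟨ModuleCat.of T _, C, C', i ∘ₗ e.toLinearMap, q, i' ∘ₗ e'.toLinearMap, q',
    ⟨hiq.inj.comp e.injective, fun y => ?_, hiq.surj⟩,
    ⟨hiq'.inj.comp e'.injective, fun y => ?_, hiq'.surj⟩, hC, hC'⟩
  · refine (hiq.exact y).trans ⟨?_, ?_⟩
    · rintro ⟨x, rfl⟩
      exact ⟨e.symm x, by simp⟩
    · rintro ⟨x, rfl⟩
      exact ⟨e x, rfl⟩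
  · refine (hiq'.exact y).trans ⟨?_, ?_⟩
    · rintro ⟨x, rfl⟩
      exact ⟨e'.symm x, by simp⟩
    · rintro ⟨x, rfl⟩
      exact ⟨e' x, rfl⟩

lemma IsGorensteinTranspose.nonempty_extEquiv [IsNoetherianRing S] (hD : IsDualizing S T D)
    {B N N' : Type u} [AddCommGroup B] [Module S B] [AddCommGroup N] [Module T N]
    [AddCommGroup N'] [Module T N']
    (h : IsGorensteinTranspose S T D B N) (h' : IsGorensteinTranspose S T D B N')
    {i : ℕ} (hi : 1 ≤ i) : Nonempty (ExtD T D N i ≃ₗ[S] ExtD T D N' i) := by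
  have := hD.symm.projective_left
  obtain ⟨E, C, C', a, p, a', p', hap, hap', hC, hC'⟩ := h.exists_common_extension hD h'
  obtain ⟨e⟩ := ExtVanish.nonempty_extEquiv T S D hap hC.extVanish hi
  obtain ⟨e'⟩ := ExtVanish.nonempty_extEquiv T S D hap' hC'.extVanish hi
  exact ⟨e.symm.trans e'⟩

lemma IsGorensteinTranspose.Gpd_eq [IsNoetherianRing S] (hD : IsDualizing S T D)
    {B N N' : Type u} [AddCommGroup B] [Module S B] [AddCommGroup N] [Module T N]
    [AddCommGroup N'] [Module T N']
    (h : IsGorensteinTranspose S T D B N) (h' : IsGorensteinTranspose S T D B N') :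
    Gpd T N = Gpd T N' := by
  obtain ⟨E, C, C', a, p, a', p', hap, hap', hC, hC'⟩ := h.exists_common_extension hD h'
  rw [Gpd_eq_of_isSES hap hC, Gpd_eq_of_isSES hap' hC']

/-- Torsionfreeness can be tested on any Gorenstein transpose. -/
lemma IsGorensteinTranspose.isTorsionfree_iff [IsNoetherianRing S] (hD : IsDualizing S T D)
    {A M : Type u} [AddCommGroup A] [Module S A] [AddCommGroup M] [Module T M]
    (h : IsGorensteinTranspose S T D A M) (n : ℕ) :
    IsTorsionfree S T D n A ↔ ∀ i : ℕ, 1 ≤ i → i ≤ n → Subsingleton (ExtD T D M i) := by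
  constructor
  · rintro ⟨M', hM', hvan⟩ i hi hin
    obtain ⟨e⟩ := h.nonempty_extEquiv hD hM'.isGorensteinTranspose hi
    have := hvan i hi hin
    exact e.toEquiv.subsingleton
  · intro hvan
    have : Module.Finite S A := by
      obtain ⟨-, X₀, -, p, -, hf, -, -, -, hp, -⟩ := h
      exact Module.Finite.of_surjective p hp
    obtain ⟨M', hM'⟩ := exists_isTranspose S T D A
    refine ⟨M', hM', fun i hi hin => ?_⟩
    obtain ⟨e⟩ := h.nonempty_extEquiv hD hM'.isGorensteinTranspose hi
    have := hvan i hi hin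
    exact e.symm.toEquiv.subsingleton

lemma isDualizing_self (R : Type u) [Ring R] : IsDualizing R Rᵐᵒᵖ R where
  left := ⟨LinearEquiv.refl R R⟩
  right := ⟨{ MulOpposite.opAddEquiv with map_smul' := fun _ _ => rfl }⟩
  left_surj φ := ⟨φ 1, fun x => by
    have := φ.map_smul (MulOpposite.op x) 1
    simpa using this⟩
  right_surj φ := ⟨MulOpposite.op (φ 1), fun x => by
    have := φ.map_smul x 1
    simpa using this⟩

end Comparison

end GorensteinTranspose

open GorensteinTranspose in
theorem corollary3p5 (R : Type u) [Ring R] [IsNoetherianRing R] [IsNoetherianRing Rᵐᵒᵖ]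
    (A : Type u) [AddCommGroup A] [Module R A] [Module.Finite R A]
    (M : Type u) [AddCommGroup M] [Module Rᵐᵒᵖ M]
    (hM : IsGorensteinTranspose R Rᵐᵒᵖ R A M)
    (N : Type u) [AddCommGroup N] [Module R N]
    (hN : IsGorensteinTranspose Rᵐᵒᵖ R R M N) :
    (∀ i : ℕ, 1 ≤ i → Nonempty (ExtD R R N i ≃ₗ[Rᵐᵒᵖ] ExtD R R A i)) ∧
    (∀ n : ℕ, 1 ≤ n → (IsTorsionfree R Rᵐᵒᵖ R n N ↔ IsTorsionfree R Rᵐᵒᵖ R n A)) ∧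
    Gpd R N = Gpd R A := by
  have hD := isDualizing_self R
  have hA := hM.symm hD
  have hM' := hN.symm hD.symm
  exact ⟨fun i hi => hN.nonempty_extEquiv hD.symm hA hi,
    fun n _ => by rw [hM'.isTorsionfree_iff hD, hM.isTorsionfree_iff hD],
    hN.Gpd_eq hD.symm hA⟩
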